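/- Let $n\ge 1$ and $p>1$ be integers, let $G\subset GL(p,\mathbb R)$ be a Lie subgroup with Lie algebra $\mathfrak g=T_IG\subset M_p(\mathbb R)$, and let $f:(\mathbb R^n,0)\to(\mathbb R^p,0)$ be a germ at $0$ of a $C^\infty$ map with $f(0)=0$. Let $\theta(f)$ be the real vector space of germs at $0$ of $C^\infty$ vector fields along $f$ (equivalently, of germs at $0$ of $C^\infty$ maps $\mathbb R^n\to\mathbb R^p$), let $\theta(n)$ be the space of germs at $0$ of $C^\infty$ vector fields on $\mathbb R^n$, and put $$T\mathcal R_e(f)=\{df\circ\zeta \mid \zeta\in\theta(n)\},\qquad \mathfrak g(f)=\{X f \mid X\in\mathfrak g\},\qquad T(\mathcal R\times G)_e(f)=T\mathcal R_e(f)+\mathfrak g(f)\subset\theta(f),$$ where $(Xf)(x)=X\,f(x)$. If $$\dim_{\mathbb R}\theta(f)/T(\mathcal R\times G)_e(f)<\infty,$$ then $f$ is a submersion germ, that is, the differential $df_0:\mathbb R^n\to\mathbb R^p$ is surjective. -/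

import Mathlib

open scoped Manifold ContDiff Topology

noncomputable section

/-- The real vector space `C^∞(n,p)` of germs at `0` of smooth maps `ℝⁿ → ℝᵖ`, that is, of maps
which are `C^∞` on some neighbourhood of `0`. (No condition on the value at `0`.)
For `p = n` this is also the space `θ(n)` of germs at `0` of smooth vector fields on `ℝⁿ`. -/
def SmoothGerms (n p : ℕ) :
    Submodule ℝ (Filter.Germ (𝓝 (0 : EuclideanSpace ℝ (Fin n))) (EuclideanSpace ℝ (Fin p))) where
  carrier := {g | ∃ φ : EuclideanSpace ℝ (Fin n) → EuclideanSpace ℝ (Fin p),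
    (∀ᶠ x in 𝓝 0, ContDiffAt ℝ ∞ φ x) ∧ g = (φ : Filter.Germ _ _)}
  add_mem' := by
    rintro _ _ ⟨φ, hφ, rfl⟩ ⟨ψ, hψ, rfl⟩
    exact ⟨φ + ψ, (hφ.and hψ).mono fun x h => h.1.add h.2, rfl⟩
  zero_mem' := ⟨0, Filter.Eventually.of_forall fun _ => contDiffAt_const, rfl⟩
  smul_mem' := by
    rintro c _ ⟨φ, hφ, rfl⟩
    exact ⟨c • φ, hφ.mono fun x h => h.const_smul c, rfl⟩

/-- The germ at `0` of the differential `x ↦ df_x` of a germ `f`. -/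
def germDiff {n p : ℕ}
    (f : Filter.Germ (𝓝 (0 : EuclideanSpace ℝ (Fin n))) (EuclideanSpace ℝ (Fin p))) :
    Filter.Germ (𝓝 (0 : EuclideanSpace ℝ (Fin n)))
      (EuclideanSpace ℝ (Fin n) →L[ℝ] EuclideanSpace ℝ (Fin p)) :=
  Quotient.map' (fderiv ℝ) (fun _ _ h => Filter.EventuallyEq.fderiv h) f

/-- The differential of `f` at the base point `0`. -/
def diffAtZero {n p : ℕ} (f : SmoothGerms n p) :
    EuclideanSpace ℝ (Fin n) →L[ℝ] EuclideanSpace ℝ (Fin p) :=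
  (germDiff f.1).value

/-- `f` is a submersion germ: its differential at `0` is surjective. -/
def IsSubmersionGerm {n p : ℕ} (f : SmoothGerms n p) : Prop :=
  Function.Surjective (diffAtZero f)

/-- The space `θ(f)` of germs of smooth vector fields along `f`. Since `Tℝᵖ` is trivial, a vector
field `∑ ηⱼ ∂/∂yⱼ ∘ f` along `f` is the germ `η = (η₁, …, ηₚ)`. -/
abbrev Theta {n p : ℕ} (_f : SmoothGerms n p) : Type := SmoothGerms n p

/-- The map `tf : θ(n) → θ(f)`, `tf(ζ) = df ∘ ζ`. -/
def tMap {n p : ℕ} (f : SmoothGerms n p) : SmoothGerms n n →ₗ[ℝ] Theta f where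
  toFun ζ := ⟨Filter.Germ.map₂ (fun L v => L v) (germDiff f.1) ζ.1, by
    obtain ⟨_, φ, hφ, rfl⟩ := f
    obtain ⟨_, ζ, hζ, rfl⟩ := ζ
    refine ⟨fun x => fderiv ℝ φ x (ζ x), ?_, rfl⟩
    filter_upwards [hφ, hζ] with x h1 h2
    exact (h1.fderiv_right (m := ∞) (by simp)).clm_apply h2⟩
  map_add' := by
    rintro ⟨_, ζ, hζ, rfl⟩ ⟨_, ξ, hξ, rfl⟩
    obtain ⟨_, φ, hφ, rfl⟩ := f
    refine Subtype.ext (congrArg Filter.Germ.ofFun (funext fun x => ?_))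
    exact map_add (fderiv ℝ φ x) (ζ x) (ξ x)
  map_smul' := by
    rintro c ⟨_, ζ, hζ, rfl⟩
    obtain ⟨_, φ, hφ, rfl⟩ := f
    refine Subtype.ext (congrArg Filter.Germ.ofFun (funext fun x => ?_))
    exact map_smul (fderiv ℝ φ x) c (ζ x)

/-- The extended tangent space `Tℛₑ(f) = tf(θ(n))`. -/
def TRe {n p : ℕ} (f : SmoothGerms n p) : Submodule ℝ (Theta f) :=
  LinearMap.range (tMap f)

/-- The linear map `X ↦ X.f`, where `(X.f)(x) = X f(x)`, from matrices to `θ(f)`. -/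
def matAct {n p : ℕ} (f : SmoothGerms n p) : Matrix (Fin p) (Fin p) ℝ →ₗ[ℝ] Theta f where
  toFun X := ⟨Filter.Germ.map (Matrix.toEuclideanCLM (𝕜 := ℝ) X) f.1, by
    obtain ⟨_, φ, hφ, rfl⟩ := f
    refine ⟨fun x => Matrix.toEuclideanCLM (𝕜 := ℝ) X (φ x), ?_, rfl⟩
    exact hφ.mono fun x h => (Matrix.toEuclideanCLM (𝕜 := ℝ) X).contDiff.contDiffAt.comp x h⟩
  map_add' := by
    intro X Y
    obtain ⟨_, φ, hφ, rfl⟩ := f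
    refine Subtype.ext (congrArg Filter.Germ.ofFun (funext fun x => ?_))
    simp
  map_smul' := by
    intro c X
    obtain ⟨_, φ, hφ, rfl⟩ := f
    refine Subtype.ext (congrArg Filter.Germ.ofFun (funext fun x => ?_))
    simp

/-- The entries of an invertible matrix: the inclusion of `GL(p,ℝ)` into the vector space
`M_p(ℝ) = ℝ^{p × p}`. -/
def glEntries {p : ℕ} (A : GL (Fin p) ℝ) : Fin p → Fin p → ℝ :=
  fun i j => (A : Matrix (Fin p) (Fin p) ℝ) i j

/-- A Lie subgroup of `GL(p,ℝ)`: a subgroup `G` with a smooth manifold structure that makes `G` a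
Lie group and the inclusion `G → GL(p,ℝ) ⊂ M_p(ℝ)` a smooth immersion. The topology `top` of the
manifold `G` may be finer than the subspace topology, so `G` need not be closed in `GL(p,ℝ)`. -/
structure LieSubgroupGL (p : ℕ) where
  /-- the underlying group -/
  group : Subgroup (GL (Fin p) ℝ)
  /-- the dimension of the manifold -/
  dim : ℕ
  /-- the manifold topology -/
  [top : TopologicalSpace group]
  /-- the atlas -/
  [charts : ChartedSpace (EuclideanSpace ℝ (Fin dim)) group]
  [lieGroup : LieGroup (𝓡 dim) ∞ group]
  smooth_incl : ContMDiff (𝓡 dim) 𝓘(ℝ, Fin p → Fin p → ℝ) ∞ (fun A : group => glEntries A.1)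
  immersion_incl : ∀ A : group, Function.Injective
    (mfderiv (𝓡 dim) 𝓘(ℝ, Fin p → Fin p → ℝ) (fun A : group => glEntries A.1) A)

/-- The inclusion `T_I G → M_p(ℝ)`: the differential at the identity of the inclusion of `G`. -/
def LieSubgroupGL.tangentIncl {p : ℕ} (G : LieSubgroupGL p) :
    EuclideanSpace ℝ (Fin G.dim) →L[ℝ] (Fin p → Fin p → ℝ) :=
  letI := G.top
  letI := G.charts
  mfderiv (𝓡 G.dim) 𝓘(ℝ, Fin p → Fin p → ℝ) (fun A : G.group => glEntries A.1) 1

/-- The Lie algebra `𝔤 = T_I G ⊂ M_p(ℝ)` of `G`. -/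
def LieSubgroupGL.lieAlg {p : ℕ} (G : LieSubgroupGL p) :
    Submodule ℝ (Matrix (Fin p) (Fin p) ℝ) :=
  (LinearMap.range G.tangentIncl.toLinearMap).map
    (Matrix.ofLinearEquiv ℝ : (Fin p → Fin p → ℝ) ≃ₗ[ℝ] Matrix (Fin p) (Fin p) ℝ).toLinearMap

/-- The extended tangent space `T(ℛ×G)ₑ(f) = Tℛₑ(f) + 𝔤(f)`, where `𝔤(f) = {X.f | X ∈ 𝔤}`. -/
def TRGe {n p : ℕ} (G : LieSubgroupGL p) (f : SmoothGerms n p) : Submodule ℝ (Theta f) :=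
  TRe f ⊔ G.lieAlg.map (matAct f)

end

open Asymptotics

/-! Since `𝔤` is finite-dimensional, `𝔤(f)` cannot affect finiteness of codimension, so already `TRe
f` has finite codimension. Suppose `df₀` is not surjective. Choose a functional `l` that kills its
image and a second functional `m` independent of `l`. Applying them to the columns of `df` gives a
`2 × n` matrix of germs whose first row vanishes at the origin.

The ring of smooth germs is not Noetherian, so the matrix is replaced by Taylor polynomials,
truncated beyond the codimension `K`. Finite codimension survives modulo the power `K + 1` of the
ideal of the origin. Stabilization of powers and Nakayama's lemma then remove the error: up to a
factor `s` with `s(0) = 1`, the image of the polynomial matrix contains the `K`-th power of that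
ideal times the free module of rank two (`Submodule.exists_smul_pow_smul_le`). Near the origin,
then, the matrix can have rank at most one only at the origin itself.

This contradicts the determinantal dimension bound: the locus of rank at most one passes through the
origin and has codimension at most `n - 1` there. The bound follows from Krull's height theorem on
the Segre cone (`MvPolynomial.exists_prime_of_specializations`,
`MvPolynomial.false_of_cokernel_supported_at_origin`). -/

/-! ### Heights of primes through successive specializations -/

/-- A strictly increasing chain of primes bounds the height from below. -/
theorem Ideal.natCast_le_height_of_chain {R : Type*} [CommRing R] (P : ℕ → Ideal R)
    (hP : ∀ i, (P i).IsPrime) (N : ℕ) (h : ∀ i < N, P i < P (i + 1)) :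
    (N : ℕ∞) ≤ (P N).height := by
  induction N with
  | zero => simp
  | succ m ih =>
    have := hP m
    have := hP (m + 1)
    have h1 := ih fun i hi => h i (by omega)
    have h2 := Ideal.height_add_one_le_of_lt_of_isPrime (h m (by omega))
    push_cast
    exact le_trans (by gcongr) h2

namespace MvPolynomial

/-- The substitution that kills the variables of rank less than `j`. -/
noncomputable def killLT {τ : Type*} (k : Type*) [CommRing k] (r : τ → ℕ) (j : ℕ) :
    MvPolynomial τ k →ₐ[k] MvPolynomial τ k :=
  aeval fun v => if r v < j then 0 else X v

theorem killLT_X {τ k : Type*} [CommRing k] (r : τ → ℕ) (j : ℕ) (v : τ) :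
    killLT k r j (X v) = if r v < j then 0 else X v := by
  simp [killLT]

/-- This makes the kernels of the successive specializations nested. -/
theorem killLT_succ {τ k : Type*} [CommRing k] (r : τ → ℕ) (j : ℕ) (p : MvPolynomial τ k) :
    killLT k r (j + 1) p = killLT k r (j + 1) (killLT k r j p) := by
  have : killLT k r (j + 1) = (killLT k r (j + 1)).comp (killLT k r j) := by
    ext1 v
    simp only [AlgHom.comp_apply, killLT_X]
    split_ifs with h1 h2 h2
    · simp
    · simp [killLT_X, h1]
    · omega
    · simp [killLT_X, h1]
  exact DFunLike.congr_fun this p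

/-- Krull's height theorem on the image of a polynomial map: `N` successive specializations of the
variables force every system of fewer than `N` equations to have a prime strictly below the last
specialization. -/
theorem exists_prime_of_specializations {k : Type*} [Field k] {σ τ : Type*} [Finite σ]
    (φ : MvPolynomial σ k →ₐ[k] MvPolynomial τ k) (r : τ → ℕ) (N : ℕ)
    (w : ℕ → MvPolynomial σ k)
    (hw0 : ∀ j < N, killLT k r (j + 1) (φ (w j)) = 0)
    (hw1 : ∀ j < N, killLT k r j (φ (w j)) ≠ 0)
    (s : Finset (MvPolynomial σ k)) (hs : s.card < N) (hsN : ∀ f ∈ s, killLT k r N (φ f) = 0) :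
    ∃ Q : Ideal (MvPolynomial σ k), Q.IsPrime ∧ (∀ f, φ f = 0 → f ∈ Q) ∧ (∀ f ∈ s, f ∈ Q) ∧
      (∀ f ∈ Q, killLT k r N (φ f) = 0) ∧ ∃ g, g ∉ Q ∧ killLT k r N (φ g) = 0 := by
  classical
  let ψ := φ.rangeRestrict
  have hψ : Function.Surjective ψ := φ.rangeRestrict_surjective
  have : IsNoetherianRing φ.range := isNoetherianRing_of_surjective _ _ ψ.toRingHom hψ
  -- The chain lives in the image of `φ`, so that the pullback of any prime contains the kernel of
  -- `φ`. The `w j` witness that its inclusions are strict.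
  let P : ℕ → Ideal φ.range := fun j => RingHom.ker ((killLT k r j).comp φ.range.val)
  have hP : ∀ j, (P j).IsPrime := fun j => RingHom.ker_isPrime _
  have memP : ∀ j f, ψ f ∈ P j ↔ killLT k r j (φ f) = 0 := fun j f => Iff.rfl
  have hlt : ∀ j < N, P j < P (j + 1) := by
    intro j hj
    refine lt_of_le_of_ne (fun x hx => ?_) fun h => ?_
    · obtain ⟨f, rfl⟩ := hψ x
      rw [memP] at hx ⊢
      rw [killLT_succ, hx, map_zero]
    · have := (memP (j + 1) (w j)).2 (hw0 j hj)
      rw [← h, memP] at this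
      exact hw1 j hj this
  have hheight := Ideal.natCast_le_height_of_chain P hP N hlt
  have hle : Ideal.span (s.image ψ : Set φ.range) ≤ P N := by
    rw [Ideal.span_le]
    intro x hx
    obtain ⟨f, hf, rfl⟩ := Finset.mem_image.1 (Finset.mem_coe.1 hx)
    exact (memP N f).2 (hsN f hf)
  have := hP N
  obtain ⟨Q, hQ, hQP⟩ := Ideal.exists_minimalPrimes_le hle
  have hQp : Q.IsPrime := hQ.1.1
  -- Krull: a minimal prime over fewer than `N` elements has height less than `N`, while `P N` has
  -- height at least `N`.
  have hne : Q ≠ P N := by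
    rintro rfl
    have h1 := Ideal.height_le_card_of_mem_minimalPrimes_span_finset hQ
    have h2 := hheight.trans h1
    have h3 : N ≤ (s.image ψ).card := by exact_mod_cast h2
    have := Finset.card_image_le (s := s) (f := ψ)
    omega
  obtain ⟨x, hx, hxQ⟩ := SetLike.exists_of_lt (lt_of_le_of_ne hQP hne)
  obtain ⟨g, rfl⟩ := hψ x
  refine ⟨Q.comap ψ, Ideal.comap_isPrime _ _, fun f hf => ?_, fun f hf => ?_, fun f hf => ?_,
    g, hxQ, hx⟩
  · have : ψ f = 0 := Subtype.ext hf
    rw [Ideal.mem_comap, this]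
    exact Q.zero_mem
  · have h : ψ f ∈ Ideal.span (s.image ψ : Set φ.range) :=
      Ideal.subset_span (Finset.mem_coe.2 (Finset.mem_image_of_mem ψ hf))
    have hI : Ideal.span (s.image ψ : Set φ.range) ≤ Q := hQ.1.2
    rw [Ideal.mem_comap]
    exact hI h
  · have h : ψ f ∈ Q := Ideal.mem_comap.1 hf
    exact (memP N f).1 (hQP h)

/-! ### The determinantal locus of a `2 × n` matrix -/

/-- A `2 × n` matrix of rank at most one over a domain cannot have a nonzero multiple of the
identity in its column space. -/
theorem eq_zero_of_minors_eq_zero {D ι : Type*} [CommRing D] [IsDomain D] [Fintype ι]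
    {a b u w : ι → D} {t : D} (hab : ∀ i j, a i * b j = a j * b i)
    (hau : ∑ i, a i * u i = t) (hbu : ∑ i, b i * u i = 0)
    (hbw : ∑ i, b i * w i = t) : t = 0 := by
  have : t * t = 0 := by
    -- The vanishing minors let `a` and `b` trade places in the product, which brings out the zero
    -- factor `∑ b u`.
    calc t * t = (∑ i, a i * u i) * ∑ j, b j * w j := by rw [hau, hbw]
      _ = (∑ i, b i * u i) * ∑ j, a j * w j := by
        simp only [Finset.sum_mul_sum]
        refine Finset.sum_congr rfl fun i _ => Finset.sum_congr rfl fun j _ => ?_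
        linear_combination (u i * w j) * hab i j
      _ = 0 := by rw [hbu, zero_mul]
  simpa using this

theorem mem_of_forall_X_mem {σ k : Type*} [CommRing k] {Q : Ideal (MvPolynomial σ k)}
    (h : ∀ v, X v ∈ Q) {g : MvPolynomial σ k} (hg : constantCoeff g = 0) : g ∈ Q := by
  have : Ideal.Quotient.mk Q = (Ideal.Quotient.mk Q).comp (C.comp constantCoeff) := by
    refine ringHom_ext (fun r => by simp) fun v => ?_
    simpa using Ideal.Quotient.eq_zero_iff_mem.2 (h v)
  rw [← Ideal.Quotient.eq_zero_iff_mem, this]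
  simp [hg]

theorem minor_mem {R : Type*} [CommRing R] {Q : Ideal R} {a b a' b' p q p' q' : R}
    (ha : p - a ∈ Q) (hb : q - b ∈ Q) (ha' : p' - a' ∈ Q) (hb' : q' - b' ∈ Q)
    (h : p * q' - p' * q ∈ Q) : a * b' - a' * b ∈ Q := by
  simp only [← Ideal.Quotient.eq_zero_iff_mem, map_sub, map_mul, sub_eq_zero] at *
  rw [← ha, ← hb, ← ha', ← hb', h]

/-- The parametrization of the Segre cone of rank one `2 × n` matrices `(α tᵢ, β tᵢ)`,
over the polynomial ring in `x₁, …, xₙ`. -/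
noncomputable def segre (k : Type*) [CommRing k] (n : ℕ) :
    MvPolynomial (Fin n ⊕ (Fin n ⊕ Fin n)) k →ₐ[k] MvPolynomial (Fin n ⊕ (Fin n ⊕ Bool)) k :=
  aeval (Sum.elim (fun i => X (Sum.inl i)) (Sum.elim
    (fun i => X (Sum.inr (Sum.inr true)) * X (Sum.inr (Sum.inl i)))
    (fun i => X (Sum.inr (Sum.inr false)) * X (Sum.inr (Sum.inl i)))))

/-- The order in which the parameters of the Segre cone are specialized to zero:
`x₁, …, xₙ, t₁, …, tₙ₋₁, α, β`, with `tₙ` left over. -/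
def segreRank (n : ℕ) : Fin n ⊕ (Fin n ⊕ Bool) → ℕ :=
  Sum.elim (fun i => i) (Sum.elim (fun i => if (i : ℕ) + 1 < n then n + i else 2 * n + 1)
    fun c => if c then 2 * n - 1 else 2 * n)

/-- The Segre cone times affine `n`-space has dimension `2n + 1`, so `2n` equations through the
origin leave a component of positive dimension there. -/
theorem exists_prime_segre {k : Type*} [Field k] {n : ℕ} (hn : 0 < n)
    (s : Finset (MvPolynomial (Fin n ⊕ (Fin n ⊕ Fin n)) k)) (hs : s.card ≤ 2 * n)
    (hs0 : ∀ f ∈ s, constantCoeff f = 0) :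
    ∃ Q : Ideal (MvPolynomial (Fin n ⊕ (Fin n ⊕ Fin n)) k), Q.IsPrime ∧
      (∀ f, segre k n f = 0 → f ∈ Q) ∧ (∀ f ∈ s, f ∈ Q) ∧
      (∀ f ∈ Q, constantCoeff f = 0) ∧ ∃ g, g ∉ Q ∧ constantCoeff g = 0 := by
  have hN : ∀ f, killLT k (segreRank n) (2 * n + 1) (segre k n f) = C (constantCoeff f) := by
    intro f
    have : (killLT k (segreRank n) (2 * n + 1)).comp (segre k n) = aeval 0 := by
      ext1 v
      rcases v with i | i | i
      · have : (i : ℕ) < 2 * n + 1 := by omega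
        simp [segre, killLT_X, segreRank, this]
      · have : 2 * n - 1 < 2 * n + 1 := by omega
        simp [segre, killLT_X, segreRank, this]
      · simp [segre, killLT_X, segreRank]
    have h := DFunLike.congr_fun this f
    rw [AlgHom.comp_apply] at h
    rw [h, aeval_zero]
    rfl
  have hN0 : ∀ f, killLT k (segreRank n) (2 * n + 1) (segre k n f) = 0 ↔ constantCoeff f = 0 := by
    intro f
    rw [hN, C_eq_zero]
  simp only [← hN0] at hs0 ⊢
  refine exists_prime_of_specializations (segre k n) (segreRank n) (2 * n + 1)
    -- The witnesses are `xⱼ`, then `α tᵢ` for each `i`, and last `β tₙ`. The parameter `tₙ` is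
    -- never killed, so the last two die exactly when `α` and `β` do.
    (fun j => if h : j < n then X (Sum.inl ⟨j, h⟩) else
      if h' : j + 1 < 2 * n then X (Sum.inr (Sum.inl ⟨j - n, by omega⟩)) else
      if j + 1 = 2 * n then X (Sum.inr (Sum.inl ⟨n - 1, by omega⟩)) else
        X (Sum.inr (Sum.inr ⟨n - 1, by omega⟩))) ?_ ?_ s (by omega) hs0
  · intro j hj
    split_ifs with h1 h2 h3
    · simp [segre, killLT_X, segreRank]
    · have e1 : j - n + 1 < n := by omega
      have e2 : n + (j - n) < j + 1 := by omega
      simp [segre, killLT_X, segreRank, e1, e2]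
    · have e1 : 2 * n - 1 < j + 1 := by omega
      simp [segre, killLT_X, segreRank, e1]
    · have e1 : 2 * n < j + 1 := by omega
      simp [segre, killLT_X, segreRank, e1]
  · intro j hj
    split_ifs with h1 h2 h3
    · simp [segre, killLT_X, segreRank]
    · have e1 : j - n + 1 < n := by omega
      have e2 : ¬ n + (j - n) < j := by omega
      have e3 : ¬ 2 * n - 1 < j := by omega
      simp [segre, killLT_X, segreRank, e1, e2, e3]
    · have e1 : ¬ 2 * n - 1 < j := by omega
      have e2 : ¬ n - 1 + 1 < n := by omega
      have e3 : ¬ 2 * n + 1 < j := by omega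
      simp [segre, killLT_X, segreRank, e1, e2, e3]
    · have e1 : ¬ 2 * n < j := by omega
      have e2 : ¬ n - 1 + 1 < n := by omega
      have e3 : ¬ 2 * n + 1 < j := by omega
      simp [segre, killLT_X, segreRank, e1, e2, e3]

/-- The same count in affine `(n + 1)`-space, where `n` equations cannot isolate the origin. -/
theorem exists_prime_option {k : Type*} [Field k] {n : ℕ}
    (s : Finset (MvPolynomial (Option (Fin n)) k)) (hs : s.card ≤ n)
    (hs0 : ∀ f ∈ s, constantCoeff f = 0) :
    ∃ Q : Ideal (MvPolynomial (Option (Fin n)) k), Q.IsPrime ∧ (∀ f ∈ s, f ∈ Q) ∧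
      (∀ f ∈ Q, constantCoeff f = 0) ∧ ∃ g, g ∉ Q ∧ constantCoeff g = 0 := by
  let r : Option (Fin n) → ℕ := fun o => o.elim n fun i => i
  have hN0 : ∀ f : MvPolynomial (Option (Fin n)) k,
      killLT k r (n + 1) (AlgHom.id k _ f) = 0 ↔ constantCoeff f = 0 := by
    intro f
    have : killLT k r (n + 1) = aeval 0 := by
      ext1 v
      rcases v with _ | i
      · simp [killLT_X, r]
      · have : (i : ℕ) < n + 1 := by omega
        simp [killLT_X, r, this]
    rw [this, AlgHom.id_apply, aeval_zero]
    exact C_eq_zero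
  simp only [← hN0] at hs0 ⊢
  refine (exists_prime_of_specializations (AlgHom.id k _) r (n + 1)
    (fun j => if h : j < n then X (some ⟨j, h⟩) else X none) (fun j hj => ?_) (fun j hj => ?_)
    s (by omega) hs0).imp fun Q h => ⟨h.1, h.2.2⟩
  · split_ifs with h1
    · simp [killLT_X, r]
    · have : n < j + 1 := by omega
      simp [killLT_X, r, this]
  · split_ifs with h1
    · simp [killLT_X, r]
    · have : ¬ n < j := by omega
      simp [killLT_X, r, this]

/-- If the cokernel of a `2 × n` matrix over `k[x₁, …, xₙ]`, `n ≥ 1`, is supported at the origin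
locally at the origin, then no row vanishes at the origin. -/
theorem false_of_cokernel_supported_at_origin {k : Type*} [Field k] {n : ℕ} (hn : 0 < n)
    (a b : Fin n → MvPolynomial (Fin n) k) (ha : ∀ i, constantCoeff (a i) = 0)
    (s : MvPolynomial (Fin n) k) (hs : constantCoeff s ≠ 0) (c : ℕ)
    (u w : Fin n → Fin n → MvPolynomial (Fin n) k)
    (hau : ∀ j, ∑ i, a i * u j i = s * X j ^ c) (hbu : ∀ j, ∑ i, b i * u j i = 0)
    (hbw : ∀ j, ∑ i, b i * w j i = s * X j ^ c) : False := by
  classical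
  -- Modulo a prime containing the minors the matrix has rank at most one over a domain, so `s * X j
  -- ^ c` dies there. As `s` survives, `X j` dies.
  have key : ∀ {σ : Type} (e : Fin n → σ) (Q : Ideal (MvPolynomial σ k)) (_ : Q.IsPrime)
      (_ : ∀ i j, rename e (a i * b j - a j * b i) ∈ Q) (_ : rename e s ∉ Q) (j : Fin n),
      X (e j) ∈ Q := by
    intro σ e Q hQ hab hsQ j
    let θ : MvPolynomial (Fin n) k →+* MvPolynomial σ k ⧸ Q :=
      (Ideal.Quotient.mk Q).comp (rename e).toRingHom
    have hθ : ∀ f, θ f = 0 ↔ rename e f ∈ Q := fun f => Ideal.Quotient.eq_zero_iff_mem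
    have h0 : θ (s * X j ^ c) = 0 := by
      refine eq_zero_of_minors_eq_zero (a := fun i => θ (a i)) (b := fun i => θ (b i))
        (u := fun i => θ (u j i)) (w := fun i => θ (w j i)) (fun i j => ?_) ?_ ?_ ?_
      · have := (hθ _).2 (hab i j)
        rwa [map_sub, map_mul, map_mul, sub_eq_zero] at this
      · simp only [← map_mul, ← map_sum, hau]
      · simp only [← map_mul, ← map_sum, hbu, map_zero]
      · simp only [← map_mul, ← map_sum, hbw]
    rw [map_mul, map_pow, mul_eq_zero] at h0
    rcases h0 with h | h
    · exact absurd ((hθ _).1 h) hsQ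
    · simpa using (hθ _).1 (eq_zero_of_pow_eq_zero h)
  -- If both rows vanish at the origin, intersect the Segre cone with the graph of the matrix.
  by_cases hb : ∀ i, constantCoeff (b i) = 0
  · let Z := Fin n ⊕ (Fin n ⊕ Fin n)
    let e : Fin n → Z := Sum.inl
    let F : Fin n → MvPolynomial Z k := fun i => X (Sum.inr (Sum.inl i)) - rename e (a i)
    let G : Fin n → MvPolynomial Z k := fun i => X (Sum.inr (Sum.inr i)) - rename e (b i)
    obtain ⟨Q, hQ, hφQ, hsQ, hQ0, g, hg, hg0⟩ := exists_prime_segre hn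
      (Finset.univ.image F ∪ Finset.univ.image G) (by
        refine (Finset.card_union_le _ _).trans ?_
        have h1 := Finset.card_image_le (s := Finset.univ) (f := F)
        have h2 := Finset.card_image_le (s := Finset.univ) (f := G)
        rw [Finset.card_univ, Fintype.card_fin] at h1 h2
        omega) (by
        intro f hf
        rcases Finset.mem_union.1 hf with hf | hf <;> obtain ⟨i, -, rfl⟩ := Finset.mem_image.1 hf
        · simp [F, ha]
        · simp [G, hb])
    have hF : ∀ i, F i ∈ Q := fun i => hsQ _ (by simp)
    have hG : ∀ i, G i ∈ Q := fun i => hsQ _ (by simp)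
    have hx : ∀ j, X (e j) ∈ Q := by
      refine key e Q hQ (fun i j => ?_) fun h => hs (by simpa using hQ0 _ h)
      rw [map_sub, map_mul, map_mul]
      refine minor_mem (hF i) (hG i) (hF j) (hG j) (hφQ _ ?_)
      simp only [segre, map_sub, map_mul, aeval_X, Sum.elim_inl, Sum.elim_inr]
      ring
    have hmem : ∀ f : MvPolynomial (Fin n) k, constantCoeff f = 0 → rename e f ∈ Q := by
      intro f hf
      exact mem_of_forall_X_mem (Q := Q.comap (rename e)) (fun v => by simpa using hx v) hf
    refine hg (mem_of_forall_X_mem (fun v => ?_) hg0)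
    rcases v with i | i | i
    · exact hx i
    · simpa [F] using Q.add_mem (hF i) (hmem _ (ha i))
    · simpa [G] using Q.add_mem (hG i) (hmem _ (hb i))
  · push Not at hb
    obtain ⟨i₀, hi₀⟩ := hb
    let F : Fin n → MvPolynomial (Option (Fin n)) k :=
      fun i => rename some (a i) - X none * rename some (b i)
    obtain ⟨Q, hQ, hsQ, hQ0, g, hg, hg0⟩ := exists_prime_option (Finset.univ.image F) (by
        simpa using Finset.card_image_le (s := Finset.univ) (f := F)) (by
        intro f hf
        obtain ⟨i, -, rfl⟩ := Finset.mem_image.1 hf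
        simp [F, ha])
    have hF : ∀ i, F i ∈ Q := fun i => hsQ _ (by simp)
    have hx : ∀ j, X (some j) ∈ Q := by
      refine key some Q hQ (fun i j => ?_) fun h => hs (by simpa using hQ0 _ h)
      have := Q.sub_mem (Q.mul_mem_right (rename some (b j)) (hF i))
        (Q.mul_mem_right (rename some (b i)) (hF j))
      rw [map_sub, map_mul, map_mul]
      convert this using 1
      ring
    have hmem : rename some (a i₀) ∈ Q :=
      mem_of_forall_X_mem (Q := Q.comap (rename some)) (fun v => by simpa using hx v) (ha i₀)
    refine hg (mem_of_forall_X_mem (fun v => ?_) hg0)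
    rcases v with _ | i
    · have h1 : X none * rename some (b i₀) ∈ Q := by simpa [F] using Q.sub_mem hmem (hF i₀)
      refine (hQ.mem_or_mem h1).resolve_right fun h => hi₀ (by simpa using hQ0 _ h)
    · exact hx i
end MvPolynomial

/-! ### Finite codimension and Nakayama's lemma -/

/-- In a finite-dimensional quotient, the powers of an ideal stabilize within as many steps as the
dimension. -/
theorem Submodule.pow_smul_top_eq_of_finrank_le {k R M : Type*} [Field k] [CommRing R]
    [AddCommGroup M] [Module k M] [Module R M] [SMul k R] [IsScalarTower k R M]
    [FiniteDimensional k M] (I : Ideal R) (c : ℕ) (hc : Module.finrank k M ≤ c) :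
    (I ^ c • ⊤ : Submodule R M) = I ^ (c + 1) • ⊤ := by
  let D : ℕ → Submodule R M := fun j => I ^ j • ⊤
  have hD : ∀ j, D (j + 1) = I • D j := fun j => by
    simp only [D, pow_succ', Submodule.mul_smul]
  have hle : ∀ j, D (j + 1) ≤ D j := fun j => (hD j).le.trans Submodule.smul_le_right
  -- Otherwise the dimension would drop `c + 1` times, starting from at most `c`.
  obtain ⟨j, hj, h⟩ : ∃ j ≤ c, D j = D (j + 1) := by
    by_contra! h
    have : ∀ j ≤ c + 1, Module.finrank k ((D j).restrictScalars k) + j ≤ c := by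
      intro j hj
      induction j with
      | zero => exact (Submodule.finrank_le _).trans hc
      | succ i ih =>
        have h1 := ih (by omega)
        have h2 : D (i + 1) < D i := lt_of_le_of_ne (hle i) (h i (by omega)).symm
        have h3 : (D (i + 1)).restrictScalars k < (D i).restrictScalars k := h2
        have := Submodule.finrank_lt_finrank_of_lt h3
        omega
    have := this (c + 1) le_rfl
    omega
  have hst : ∀ i, D (j + i) = D (j + i + 1) := by
    intro i
    induction i with
    | zero => exact h
    | succ i ih => rw [← add_assoc, hD, hD (j + i + 1), ← ih]
  have := hst (c - j)
  rwa [Nat.add_sub_cancel' hj] at this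

/-- Local finite length from finite codimension modulo a high power of the ideal. -/
theorem Submodule.exists_smul_pow_smul_le {k R M V : Type*} [Field k] [CommRing R]
    [AddCommGroup M] [Module k M] [Module R M] [SMul k R] [IsScalarTower k R M]
    [Module.Finite R M] [AddCommGroup V] [Module k V] [FiniteDimensional k V]
    (I : Ideal R) (hI : I.FG) (W : Submodule R M) (T : M →ₗ[k] V)
    (hT : ∀ x, T x = 0 → x ∈ W ⊔ I ^ (Module.finrank k V + 1) • ⊤) :
    ∃ s : R, s - 1 ∈ I ∧ ∀ r ∈ I ^ (Module.finrank k V), ∀ x : M, s • r • x ∈ W := by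
  set c := Module.finrank k V with hc
  set U : Submodule R M := W ⊔ I ^ (c + 1) • ⊤ with hU
  have hker : LinearMap.ker T ≤ U.restrictScalars k := fun x hx => hT x hx
  -- `M ⧸ U` is a quotient of the range of `T`, so its dimension is at most `c`.
  let q : (M ⧸ LinearMap.ker T) →ₗ[k] (M ⧸ U) :=
    (LinearMap.ker T).liftQ (U.mkQ.restrictScalars k) (fun x hx => by
      simpa using hker hx)
  have hq : Function.Surjective q := by
    intro y
    obtain ⟨x, rfl⟩ := U.mkQ_surjective y
    exact ⟨(LinearMap.ker T).mkQ x, by simp [q]⟩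
  have hfin1 : FiniteDimensional k (M ⧸ LinearMap.ker T) :=
    Module.Finite.equiv T.quotKerEquivRange.symm
  have hfin : FiniteDimensional k (M ⧸ U) := Module.Finite.of_surjective q hq
  have hrank : Module.finrank k (M ⧸ U) ≤ c := by
    refine (LinearMap.finrank_le_finrank_of_surjective hq).trans ?_
    rw [T.quotKerEquivRange.finrank_eq]
    exact Submodule.finrank_le _
  have hstab := Submodule.pow_smul_top_eq_of_finrank_le (k := k) I c hrank
  have hstep : (I ^ c • ⊤ : Submodule R M) ≤ U := by
    have h1 : (I ^ c • ⊤ : Submodule R M).map U.mkQ ≤ ⊥ := by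
      rw [Submodule.map_smul'', Submodule.map_top, Submodule.range_mkQ, hstab]
      rw [← Submodule.range_mkQ U, ← Submodule.map_top, ← Submodule.map_smul'',
        Submodule.map_le_iff_le_comap]
      rw [Submodule.comap_bot, Submodule.ker_mkQ]
      exact le_sup_right
    rw [Submodule.map_le_iff_le_comap, Submodule.comap_bot, Submodule.ker_mkQ] at h1
    exact h1
  -- Modulo `W`, the inclusion `hstep` is exactly the hypothesis of Nakayama's lemma for `I ^ c •
  -- ⊤`.
  have hnak : (I ^ c • ⊤ : Submodule R (M ⧸ W)) ≤ I • (I ^ c • ⊤) := by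
    rw [← Submodule.mul_smul, ← pow_succ', ← Submodule.range_mkQ W, ← Submodule.map_top,
      ← Submodule.map_smul'', ← Submodule.map_smul'']
    refine (Submodule.map_mono hstep).trans ?_
    rw [hU, Submodule.map_sup, Submodule.mkQ_map_self, bot_sup_eq]
  obtain ⟨s, hs, hs'⟩ := Submodule.exists_sub_one_mem_and_smul_eq_zero_of_fg_of_le_smul I
    (I ^ c • ⊤ : Submodule R (M ⧸ W))
    ((Module.Finite.fg_top).smul (hI.pow (n := c))) hnak
  refine ⟨s, hs, fun r hr x => ?_⟩
  have := hs' (r • W.mkQ x) (Submodule.smul_mem_smul hr trivial)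
  rw [← map_smul, ← map_smul] at this
  exact (Submodule.Quotient.mk_eq_zero W).1 this

namespace MvPolynomial

theorem mem_idealOfVars_iff {σ R : Type*} [CommRing R] (p : MvPolynomial σ R) :
    p ∈ idealOfVars σ R ↔ constantCoeff p = 0 := by
  rw [← pow_one (idealOfVars σ R), mem_pow_idealOfVars_iff']
  simp only [Nat.lt_one_iff, Finsupp.degree_eq_zero_iff, forall_eq]
  rfl

/-- A `2 × n` matrix over `k[x₁, …, xₙ]`, `n ≥ 1`, with a row vanishing at the origin has image of
infinite codimension near the origin. -/
theorem false_of_finite_codim {k V : Type*} [Field k] [AddCommGroup V] [Module k V]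
    [FiniteDimensional k V] {n : ℕ} (hn : 0 < n) (a b : Fin n → MvPolynomial (Fin n) k)
    (ha : ∀ i, constantCoeff (a i) = 0)
    (T : MvPolynomial (Fin n) k × MvPolynomial (Fin n) k →ₗ[k] V)
    (hT : ∀ g h, T (g, h) = 0 → ∃ z : Fin n → MvPolynomial (Fin n) k,
      g - ∑ i, a i * z i ∈ idealOfVars (Fin n) k ^ (Module.finrank k V + 1) ∧
      h - ∑ i, b i * z i ∈ idealOfVars (Fin n) k ^ (Module.finrank k V + 1)) : False := by
  classical
  let R := MvPolynomial (Fin n) k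
  let A : (Fin n → R) →ₗ[R] R × R :=
    (Fintype.linearCombination R a).prod (Fintype.linearCombination R b)
  have hA : ∀ z, A z = (∑ i, a i * z i, ∑ i, b i * z i) := fun z => by
    simp [A, Fintype.linearCombination_apply, mul_comm]
  obtain ⟨s, hs, h⟩ := Submodule.exists_smul_pow_smul_le (idealOfVars (Fin n) k)
    (idealOfVars_fg _ _) (LinearMap.range A) T (by
      rintro ⟨g, h⟩ h0
      obtain ⟨z, hg, hh⟩ := hT g h h0
      rw [Submodule.mem_sup]
      refine ⟨A z, ⟨z, rfl⟩, (g, h) - A z, ?_, by abel⟩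
      have : (g, h) - A z = (g - ∑ i, a i * z i) • ((1, 0) : R × R)
          + (h - ∑ i, b i * z i) • ((0, 1) : R × R) := by
        rw [hA]; ext <;> simp
      rw [this]
      exact Submodule.add_mem _ (Submodule.smul_mem_smul hg trivial)
        (Submodule.smul_mem_smul hh trivial))
  have hX : ∀ j : Fin n, (X j : R) ^ Module.finrank k V ∈
      idealOfVars (Fin n) k ^ Module.finrank k V :=
    fun j => Ideal.pow_mem_pow ((mem_idealOfVars_iff _).2 (by simp)) _
  have h1 : ∀ j, ∃ u, A u = s • (X j : R) ^ Module.finrank k V • ((1, 0) : R × R) :=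
    fun j => h _ (hX j) _
  have h2 : ∀ j, ∃ u, A u = s • (X j : R) ^ Module.finrank k V • ((0, 1) : R × R) :=
    fun j => h _ (hX j) _
  choose u hu using h1
  choose w hw using h2
  simp only [hA, Prod.ext_iff, Prod.smul_mk, smul_eq_mul, mul_one, mul_zero] at hu hw
  refine false_of_cokernel_supported_at_origin hn a b ha s ?_ _ u w (fun j => (hu j).1)
    (fun j => (hu j).2) (fun j => (hw j).2)
  have := (mem_idealOfVars_iff _).1 hs
  rw [map_sub, map_one, sub_eq_zero] at this
  rw [this]
  exact one_ne_zero

end MvPolynomial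

/-! ### Taylor polynomials and order of vanishing -/

/-- The iterated derivatives of a function along a ray. -/
theorem iteratedDeriv_comp_toSpanSingleton {E : Type*} [NormedAddCommGroup E] [NormedSpace ℝ E]
    {g : E → ℝ} {s : Set E} (hs : IsOpen s) {N : ℕ∞ω} (hg : ContDiffOn ℝ N g s) (x : E)
    {t : ℝ} (ht : t • x ∈ s) {i : ℕ} (hi : i ≤ N) :
    iteratedDeriv i (fun t : ℝ => g (t • x)) t = iteratedFDeriv ℝ i g (t • x) fun _ => x := by
  let l : ℝ →L[ℝ] E := ContinuousLinearMap.toSpanSingleton ℝ x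
  have ho : IsOpen (l ⁻¹' s) := hs.preimage l.continuous
  have h := l.iteratedFDerivWithin_comp_right hg hs.uniqueDiffOn ho.uniqueDiffOn (x := t)
    (by simpa [l] using ht) hi
  rw [iteratedFDerivWithin_of_isOpen i ho (by simpa [l] using ht),
    iteratedFDerivWithin_of_isOpen i hs (by simpa [l] using ht)] at h
  have hl : g ∘ l = fun t : ℝ => g (t • x) := by
    ext t
    simp [l]
  rw [iteratedDeriv_eq_iteratedFDeriv, ← hl, h]
  simp [l]

namespace MvPolynomial

/-- A multilinear form evaluated on the diagonal is a polynomial in the coordinates. -/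
theorem exists_eval_eq_multilinear_diag {n k : ℕ}
    (M : MultilinearMap ℝ (fun _ : Fin k => EuclideanSpace ℝ (Fin n)) ℝ) :
    ∃ P : MvPolynomial (Fin n) ℝ, ∀ x : EuclideanSpace ℝ (Fin n),
      eval (fun i => x i) P = M fun _ => x := by
  let e : Fin n → EuclideanSpace ℝ (Fin n) := fun i => EuclideanSpace.single i 1
  refine ⟨∑ r : Fin k → Fin n, C (M fun j => e (r j)) * ∏ j, X (r j), fun x => ?_⟩
  have hx : x = ∑ i, x i • e i := by
    ext j
    simp [e, Pi.single_apply]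
  conv_rhs => rw [hx]
  rw [MultilinearMap.map_sum]
  simp only [map_sum, map_mul, eval_C, map_prod, eval_X, MultilinearMap.map_smul_univ, smul_eq_mul]
  exact Finset.sum_congr rfl fun r _ => mul_comm _ _

/-- **Taylor's theorem** in several variables: approximation by a polynomial. -/
theorem exists_sub_eval_isBigO {n : ℕ} {g : EuclideanSpace ℝ (Fin n) → ℝ} (K : ℕ)
    (hg : ContDiffAt ℝ (K + 1 : ℕ) g 0) :
    ∃ P : MvPolynomial (Fin n) ℝ,
      (fun x => g x - eval (fun i => x i) P) =O[𝓝 0] fun x => ‖x‖ ^ (K + 1) := by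
  choose P hP using fun k : ℕ =>
    exists_eval_eq_multilinear_diag (iteratedFDeriv ℝ k g 0).toMultilinearMap
  refine ⟨∑ k ∈ Finset.range (K + 1), C ((k.factorial : ℝ)⁻¹) * P k, ?_⟩
  have h1 : ∀ᶠ y in 𝓝 0, ContDiffAt ℝ (K + 1 : ℕ) g y := hg.eventually (by simp)
  have h2 : ∀ᶠ y in 𝓝 0, ‖iteratedFDeriv ℝ (K + 1) g y‖ < ‖iteratedFDeriv ℝ (K + 1) g 0‖ + 1 :=
    (hg.continuousAt_iteratedFDeriv le_rfl).norm.eventually_lt_const (lt_add_one _)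
  obtain ⟨ρ, hρ, hball⟩ := Metric.eventually_nhds_iff_ball.1 (h1.and h2)
  have hon : ContDiffOn ℝ (K + 1 : ℕ) g (Metric.ball 0 ρ) :=
    fun y hy => (hball y hy).1.contDiffWithinAt
  refine IsBigO.of_bound (‖iteratedFDeriv ℝ (K + 1) g 0‖ + 1) ?_
  filter_upwards [Metric.ball_mem_nhds 0 hρ] with x hx
  have hseg : ∀ t ∈ Set.uIcc (0 : ℝ) 1, t • x ∈ Metric.ball (0 : EuclideanSpace ℝ (Fin n)) ρ := by
    intro t ht
    rw [Set.uIcc_of_le zero_le_one] at ht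
    rw [mem_ball_zero_iff] at hx ⊢
    rw [norm_smul, Real.norm_eq_abs, abs_of_nonneg ht.1]
    exact (mul_le_of_le_one_left (norm_nonneg x) ht.2).trans_lt hx
  have hray : ∀ t ∈ Set.uIcc (0 : ℝ) 1, ContDiffAt ℝ (K + 1 : ℕ) (fun t : ℝ => g (t • x)) t := by
    intro t ht
    exact (hball _ (hseg t ht)).1.comp t (contDiffAt_id.smul contDiffAt_const)
  -- One-variable Taylor on the segment from the origin to `x`, parametrized by `[0, 1]`;
  -- homogeneity of the derivatives supplies the powers of `‖x‖`.
  obtain ⟨t, ht, h⟩ := taylor_mean_remainder_lagrange_iteratedDeriv (n := K)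
    (f := fun t : ℝ => g (t • x)) zero_ne_one
    (fun t ht => (hray t ht).contDiffWithinAt)
  have ht' : t ∈ Set.uIcc (0 : ℝ) 1 := Set.Ioo_subset_Icc_self ht
  have h0 : (0 : ℝ) ∈ Set.uIcc (0 : ℝ) 1 := Set.left_mem_uIcc
  have htaylor : taylorWithinEval (fun t : ℝ => g (t • x)) K (Set.uIcc 0 1) 0 1 =
      eval (fun i => x i) (∑ k ∈ Finset.range (K + 1), C ((k.factorial : ℝ)⁻¹) * P k) := by
    rw [taylor_within_apply, map_sum]
    refine Finset.sum_congr rfl fun k hk => ?_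
    have hkK : k ≤ K + 1 := (Finset.mem_range.1 hk).le
    rw [iteratedDerivWithin_eq_iteratedDeriv (uniqueDiffOn_uIcc zero_ne_one)
      ((hray 0 h0).of_le (by exact_mod_cast hkK)) h0,
      iteratedDeriv_comp_toSpanSingleton Metric.isOpen_ball hon x (hseg 0 h0)
        (by exact_mod_cast hkK), map_mul, eval_C, hP]
    simp
  rw [htaylor, iteratedDeriv_comp_toSpanSingleton Metric.isOpen_ball hon x (hseg t ht') le_rfl,
    one_smul] at h
  rw [h, sub_zero, one_pow, mul_one, norm_div, norm_pow, norm_norm]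
  have hfac : (1 : ℝ) ≤ ‖((K + 1).factorial : ℝ)‖ := by
    rw [Real.norm_natCast]
    exact_mod_cast Nat.one_le_iff_ne_zero.2 (Nat.factorial_ne_zero _)
  refine (div_le_self (norm_nonneg _) hfac).trans ?_
  refine ((iteratedFDeriv ℝ (K + 1) g (t • x)).le_opNorm _).trans ?_
  rw [Finset.prod_const, Finset.card_univ, Fintype.card_fin]
  gcongr
  exact (hball _ (hseg t ht')).2.le

end MvPolynomial

/-- A real polynomial that is `O(tᴷ)` at the origin is divisible by `Xᴷ`. -/
theorem Polynomial.X_pow_dvd_of_isBigO {q : Polynomial ℝ} {K : ℕ}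
    (h : (fun t => q.eval t) =O[𝓝[≠] 0] fun t => t ^ K) : Polynomial.X ^ K ∣ q := by
  induction K generalizing q with
  | zero => simp
  | succ K ih =>
    have hlim : Filter.Tendsto (fun t : ℝ => t ^ (K + 1)) (𝓝[≠] 0) (𝓝 0) := by
      have : Continuous fun t : ℝ => t ^ (K + 1) := by fun_prop
      simpa using (this.tendsto 0).mono_left nhdsWithin_le_nhds
    have h0 : q.eval 0 = 0 := tendsto_nhds_unique
      ((q.continuous.tendsto 0).mono_left nhdsWithin_le_nhds) (h.trans_tendsto hlim)
    have hX : Polynomial.X ∣ q := by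
      rwa [Polynomial.X_dvd_iff, Polynomial.coeff_zero_eq_eval_zero]
    obtain ⟨r, rfl⟩ := hX
    rw [pow_succ']
    refine mul_dvd_mul_left _ (ih ?_)
    have hinv := (isBigO_refl (fun t : ℝ => t⁻¹) (𝓝[≠] 0)).mul h
    refine hinv.congr' ?_ ?_ <;> filter_upwards [self_mem_nhdsWithin] with t ht
    · simp [inv_mul_cancel_left₀ ht]
    · rw [pow_succ', inv_mul_cancel_left₀ ht]

namespace MvPolynomial

theorem IsHomogeneous.eval_smul_point {σ R : Type*} [Fintype σ] [CommRing R]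
    {P : MvPolynomial σ R} {i : ℕ} (hP : P.IsHomogeneous i) (t : R) (x : σ → R) :
    eval (t • x) P = eval x P * t ^ i := by
  rw [eval_eq', eval_eq', Finset.sum_mul]
  refine Finset.sum_congr rfl fun d hd => ?_
  have hdeg : ∑ v, d v = i := by
    rw [← hP (mem_support_iff.1 hd), ← Finsupp.degree_eq_sum]
    exact DFunLike.congr_fun Finsupp.degree_eq_weight_one d
  simp only [Pi.smul_apply, smul_eq_mul, mul_pow, Finset.prod_mul_distrib,
    Finset.prod_pow_eq_pow_sum, hdeg]
  ring

/-- A real polynomial that is `O(‖x‖ᴷ)` at the origin has no terms of degree less than `K`. -/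
theorem mem_pow_idealOfVars_of_isBigO {n K : ℕ} {P : MvPolynomial (Fin n) ℝ}
    (h : (fun x : EuclideanSpace ℝ (Fin n) => eval (fun i => x i) P) =O[𝓝 0] fun x => ‖x‖ ^ K) :
    P ∈ idealOfVars (Fin n) ℝ ^ K := by
  rw [mem_pow_idealOfVars_iff']
  intro d hd
  suffices homogeneousComponent d.degree P = 0 by
    have h1 := congrArg (coeff d) this
    rwa [coeff_homogeneousComponent, if_pos rfl, coeff_zero] at h1
  refine funext fun x => ?_
  rw [map_zero]
  -- The restriction of `P` to the line through `x`: its coefficients are the values at `x` of the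
  -- homogeneous components.
  let q : Polynomial ℝ := ∑ i ∈ Finset.range (P.totalDegree + 1),
    Polynomial.C (eval x (homogeneousComponent i P)) * Polynomial.X ^ i
  have hq : ∀ t : ℝ, q.eval t = eval (t • x) P := by
    intro t
    conv_rhs => rw [← sum_homogeneousComponent P]
    rw [map_sum, Polynomial.eval_finsetSum]
    refine Finset.sum_congr rfl fun i _ => ?_
    rw [Polynomial.eval_mul, Polynomial.eval_C, Polynomial.eval_pow, Polynomial.eval_X,
      (homogeneousComponent_isHomogeneous i P).eval_smul_point]
  have hO : (fun t => q.eval t) =O[𝓝 0] fun t => t ^ K := by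
    let v : EuclideanSpace ℝ (Fin n) := WithLp.toLp 2 x
    have ht : Filter.Tendsto (fun t : ℝ => t • v) (𝓝 0) (𝓝 0) := by
      have : Continuous fun t : ℝ => t • v := by fun_prop
      simpa using this.tendsto 0
    have h1 := h.comp_tendsto ht
    have h2 : (fun t : ℝ => ‖t • v‖ ^ K) =O[𝓝 0] fun t : ℝ => t ^ K := by
      refine IsBigO.of_bound (‖v‖ ^ K) (Filter.Eventually.of_forall fun t => ?_)
      rw [norm_pow, norm_norm, norm_smul, mul_pow, norm_pow, mul_comm]
    refine (h1.trans h2).congr_left fun t => ?_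
    rw [hq]; rfl
  have hdvd := Polynomial.X_pow_dvd_iff.1 (Polynomial.X_pow_dvd_of_isBigO
    (hO.mono nhdsWithin_le_nhds)) d.degree hd
  by_cases hdeg : d.degree ∈ Finset.range (P.totalDegree + 1)
  · simpa [q,
      Polynomial.finsetSum_coeff, Polynomial.coeff_X_pow, Finset.mem_range.1 hdeg] using hdvd
  · rw [homogeneousComponent_eq_zero _ _ (by simpa using hdeg), map_zero]

end MvPolynomial

/-! ### Linear algebra of the reduction to two rows -/

/-- Enlarging a subspace by a finite-dimensional one does not affect finiteness of the
codimension. -/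
theorem Submodule.finiteDimensional_quotient_of_sup {k V : Type*} [Field k] [AddCommGroup V]
    [Module k V] (W F : Submodule k V) [FiniteDimensional k F]
    [FiniteDimensional k (V ⧸ (W ⊔ F))] : FiniteDimensional k (V ⧸ W) := by
  have : FiniteDimensional k ((V ⧸ W) ⧸ F.map W.mkQ) := by
    refine Module.Finite.of_surjective ((W ⊔ F).liftQ ((F.map W.mkQ).mkQ ∘ₗ W.mkQ) (by
        refine sup_le (fun x hx => ?_) fun x hx => ?_
        · have : W.mkQ x = 0 := by simpa using hx
          rw [LinearMap.mem_ker, LinearMap.comp_apply, this, map_zero]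
        · rw [LinearMap.mem_ker, LinearMap.comp_apply, ← LinearMap.mem_ker, Submodule.ker_mkQ]
          exact Submodule.mem_map_of_mem hx)) ?_
    intro y
    obtain ⟨z, rfl⟩ := Submodule.mkQ_surjective _ y
    obtain ⟨x, rfl⟩ := Submodule.mkQ_surjective _ z
    exact ⟨(W ⊔ F).mkQ x, rfl⟩
  exact Module.Finite.of_submodule_quotient (F.map W.mkQ)

/-- A proper subspace of a space of dimension at least two is killed by the first of a pair of
functionals which are dual to a pair of vectors. -/
theorem Submodule.exists_dual_pair {k V : Type*} [Field k] [AddCommGroup V] [Module k V]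
    [FiniteDimensional k V] (hV : 1 < Module.finrank k V) (W : Submodule k V) (hW : W < ⊤) :
    ∃ (l m : V →ₗ[k] k) (v w : V), (∀ x ∈ W, l x = 0) ∧
      l v = 1 ∧ l w = 0 ∧ m v = 0 ∧ m w = 1 := by
  obtain ⟨l, hl, hWl⟩ := W.exists_le_ker_of_lt_top hW
  obtain ⟨x, hx⟩ : ∃ x, l x ≠ 0 := by
    by_contra! h
    exact hl (LinearMap.ext h)
  obtain ⟨w, hw, hw0⟩ : ∃ w ∈ LinearMap.ker l, w ≠ 0 := by
    refine (LinearMap.ker l).exists_mem_ne_zero_of_ne_bot fun h => ?_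
    have := l.finrank_range_add_finrank_ker
    have h2 := Submodule.finrank_le (LinearMap.range l)
    rw [h, finrank_bot] at this
    rw [Module.finrank_self] at h2
    omega
  obtain ⟨m, hm⟩ : ∃ m : V →ₗ[k] k, m w ≠ 0 := by
    by_contra! h
    exact hw0 ((Module.forall_dual_apply_eq_zero_iff k w).1 h)
  -- The vector `x` is scaled so that `l` takes the value one, then corrected along `w ∈ ker l` to
  -- kill the scaled `m`.
  refine ⟨l, (m w)⁻¹ • m, (l x)⁻¹ • x - ((m w)⁻¹ * m ((l x)⁻¹ • x)) • w, w,
    fun x hx => hWl hx, ?_, hw, ?_, ?_⟩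
  · have : l w = 0 := hw
    simp [this, hx]
  · simp only [LinearMap.smul_apply, map_sub, map_smul, smul_eq_mul]
    field_simp
    ring
  · simp [hm]

/-! ### From germs to truncated polynomials, and the conclusion -/

namespace MvPolynomial

theorem continuous_eval_coords {n : ℕ} (P : MvPolynomial (Fin n) ℝ) :
    Continuous fun x : EuclideanSpace ℝ (Fin n) => eval (fun i => x i) P :=
  (continuous_eval P).comp (by fun_prop)

theorem contDiff_eval_coords {n : ℕ} {N : ℕ∞ω} (P : MvPolynomial (Fin n) ℝ) :
    ContDiff ℝ N fun x : EuclideanSpace ℝ (Fin n) => eval (fun i => x i) P := by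
  induction P using MvPolynomial.induction_on with
  | C r => simpa using contDiff_const
  | add P Q hP hQ => simpa using hP.add hQ
  | mul_X P i hP =>
    have : ContDiff ℝ N fun x : EuclideanSpace ℝ (Fin n) => x i := by fun_prop
    simpa using hP.mul this

/-- A function approximated by a polynomial to positive order has the same value at the origin. -/
theorem constantCoeff_eq_of_isBigO {n K : ℕ} {g : EuclideanSpace ℝ (Fin n) → ℝ}
    {P : MvPolynomial (Fin n) ℝ}
    (h : (fun x => g x - eval (fun i => x i) P) =O[𝓝 0] fun x => ‖x‖ ^ (K + 1)) :
    constantCoeff P = g 0 := by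
  have h1 : g 0 - eval (fun i => (0 : EuclideanSpace ℝ (Fin n)) i) P = 0 := by
    obtain ⟨c, hc⟩ := h.bound
    simpa using hc.self_of_nhds
  have h2 : eval (fun i => (0 : EuclideanSpace ℝ (Fin n)) i) P = constantCoeff P :=
    DFunLike.congr_fun eval_zero P
  rw [← h2]
  linarith

/-- Truncating all the factors of a linear relation between germs. -/
theorem sub_sum_mem_of_eventually_eq {n m K : ℕ} {g : MvPolynomial (Fin n) ℝ}
    {α ζ : Fin m → EuclideanSpace ℝ (Fin n) → ℝ} {a z : Fin m → MvPolynomial (Fin n) ℝ}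
    (hα : ∀ i, (fun x => α i x - eval (fun i => x i) (a i)) =O[𝓝 0] fun x => ‖x‖ ^ K)
    (hζ : ∀ i, (fun x => ζ i x - eval (fun i => x i) (z i)) =O[𝓝 0] fun x => ‖x‖ ^ K)
    (hζc : ∀ i, ContinuousAt (ζ i) 0)
    (h : ∀ᶠ x : EuclideanSpace ℝ (Fin n) in 𝓝 0,
      eval (fun i => x i) g = ∑ i, α i x * ζ i x) :
    g - ∑ i, a i * z i ∈ idealOfVars (Fin n) ℝ ^ K := by
  apply mem_pow_idealOfVars_of_isBigO
  -- Each error term is split as `αζ - az = (α - a)ζ + a(ζ - z)`.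
  have h1 : ∀ i, (fun x => (α i x - eval (fun i => x i) (a i)) * ζ i x +
      eval (fun i => x i) (a i) * (ζ i x - eval (fun i => x i) (z i)))
      =O[𝓝 0] fun x => ‖x‖ ^ K := by
    intro i
    refine IsBigO.add ?_ ?_
    · simpa using (hα i).mul ((hζc i).isBigO_one ℝ)
    · simpa using ((continuous_eval_coords (a i)).continuousAt.isBigO_one ℝ).mul (hζ i)
  refine (IsBigO.sum fun i (_ : i ∈ Finset.univ) => h1 i).congr' ?_ Filter.EventuallyEq.rfl
  filter_upwards [h] with x hx
  rw [map_sub, hx, map_sum, ← Finset.sum_sub_distrib]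
  simp only [Finset.sum_apply]
  refine Finset.sum_congr rfl fun i _ => ?_
  rw [map_mul]
  ring

end MvPolynomial

/-- The linear map sending a pair of polynomials `(g, h)` to the germ of `x ↦ g(x) v + h(x) w`. -/
noncomputable def polyPairGerm {n p : ℕ} (v w : EuclideanSpace ℝ (Fin p)) :
    MvPolynomial (Fin n) ℝ × MvPolynomial (Fin n) ℝ →ₗ[ℝ] SmoothGerms n p where
  toFun P := ⟨((fun x => MvPolynomial.eval (fun i => x i) P.1 • v +
      MvPolynomial.eval (fun i => x i) P.2 • w :
      EuclideanSpace ℝ (Fin n) → EuclideanSpace ℝ (Fin p)) : Filter.Germ _ _),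
    _, Filter.Eventually.of_forall fun _ =>
      (((MvPolynomial.contDiff_eval_coords P.1).smul contDiff_const).add
        ((MvPolynomial.contDiff_eval_coords P.2).smul contDiff_const)).contDiffAt, rfl⟩
  map_add' P Q := by
    refine Subtype.ext (congrArg Filter.Germ.ofFun (funext fun x => ?_))
    simp only [Prod.fst_add, Prod.snd_add, map_add, add_smul]
    abel
  map_smul' c P := by
    refine Subtype.ext (congrArg Filter.Germ.ofFun (funext fun x => ?_))
    simp [MvPolynomial.smul_eval, mul_smul]

/-- Pairing `df ∘ ζ = g v + h w` with `l` and `m` gives two scalar relations. Truncating them places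
`(g, h)` in the image of the polynomial matrix modulo high order. -/
theorem isSubmersionGerm_of_finite_codim_TRe {n p : ℕ} (hn : 0 < n) (hp : 1 < p)
    (f : SmoothGerms n p) [FiniteDimensional ℝ (Theta f ⧸ TRe f)] : IsSubmersionGerm f := by
  obtain ⟨_, φ, hφ, rfl⟩ := f
  set f : SmoothGerms n p := ⟨(φ : Filter.Germ _ _), φ, hφ, rfl⟩ with hf
  by_contra hsub
  have hD : ¬ Function.Surjective (fderiv ℝ φ 0) := hsub
  obtain ⟨l, m, v, w, hl, hlv, hlw, hmv, hmw⟩ :=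
    (LinearMap.range (fderiv ℝ φ 0).toLinearMap).exists_dual_pair (by simpa using hp)
      (lt_top_iff_ne_top.2 fun h => hD (LinearMap.range_eq_top.1 h))
  let T := (TRe f).mkQ ∘ₗ polyPairGerm (n := n) v w
  let e : Fin n → EuclideanSpace ℝ (Fin n) := fun i => EuclideanSpace.single i 1
  have he : ∀ y : EuclideanSpace ℝ (Fin n), y = ∑ i, y i • e i := by
    intro y
    ext j
    simp [e, Pi.single_apply]
  -- Taylor errors of order `K + 1`, with `K` the codimension, match the power of the ideal required
  -- by `false_of_finite_codim`.
  set K := Module.finrank ℝ (Theta f ⧸ TRe f) with hK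
  have hφ0 : ContDiffAt ℝ ∞ φ 0 := hφ.self_of_nhds
  have hrow : ∀ (q : EuclideanSpace ℝ (Fin p) →ₗ[ℝ] ℝ) (i : Fin n),
      ContDiffAt ℝ (K + 1 : ℕ) (fun x => q (fderiv ℝ φ x (e i))) 0 := by
    intro q i
    have h1 : ContDiffAt ℝ (K + 1 : ℕ) (fun x => fderiv ℝ φ x (e i)) 0 :=
      (hφ0.fderiv_right (by exact_mod_cast le_top)).clm_apply contDiffAt_const
    exact (q.toContinuousLinearMap.contDiff.contDiffAt).comp 0 h1
  choose a ha using fun i => MvPolynomial.exists_sub_eval_isBigO K (hrow l i)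
  choose b hb using fun i => MvPolynomial.exists_sub_eval_isBigO K (hrow m i)
  refine MvPolynomial.false_of_finite_codim hn a b (fun i => ?_) T fun g h hT => ?_
  · rw [MvPolynomial.constantCoeff_eq_of_isBigO (ha i)]
    exact hl _ ⟨e i, rfl⟩
  · have hmem : polyPairGerm v w (g, h) ∈ TRe f := by
      simpa [T] using hT
    obtain ⟨⟨_, ζ, hζ, rfl⟩, hζeq⟩ := hmem
    have hev : ∀ᶠ x in 𝓝 (0 : EuclideanSpace ℝ (Fin n)), fderiv ℝ φ x (ζ x) =
        MvPolynomial.eval (fun i => x i) g • v + MvPolynomial.eval (fun i => x i) h • w :=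
      Filter.Germ.coe_eq.1 (congrArg Subtype.val hζeq)
    have hζ0 : ContDiffAt ℝ ∞ ζ 0 := hζ.self_of_nhds
    have hζi : ∀ i, ContDiffAt ℝ ∞ (fun x => ζ x i) 0 := fun i =>
      (EuclideanSpace.proj (𝕜 := ℝ) i).contDiff.contDiffAt.comp 0 hζ0
    choose z hz using fun i => MvPolynomial.exists_sub_eval_isBigO K
      ((hζi i).of_le (by exact_mod_cast le_top))
    have hexp : ∀ (q : EuclideanSpace ℝ (Fin p) →ₗ[ℝ] ℝ) (x : EuclideanSpace ℝ (Fin n)),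
        q (fderiv ℝ φ x (ζ x)) = ∑ i, q (fderiv ℝ φ x (e i)) * ζ x i := by
      intro q x
      conv_lhs => rw [he (ζ x)]
      simp [mul_comm]
    refine ⟨z, MvPolynomial.sub_sum_mem_of_eventually_eq ha hz (fun i => (hζi i).continuousAt) ?_,
      MvPolynomial.sub_sum_mem_of_eventually_eq hb hz (fun i => (hζi i).continuousAt) ?_⟩
    · filter_upwards [hev] with x hx
      rw [← hexp, hx]
      simp [hlv, hlw]
    · filter_upwards [hev] with x hx
      rw [← hexp, hx]
      simp [hmv, hmw]

theorem proposition5p2 {n p : ℕ} (hn : 0 < n) (hp : 1 < p) (G : LieSubgroupGL p)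
    (f : SmoothGerms n p) (hf0 : f.1.value = 0)
    (hfin : FiniteDimensional ℝ (Theta f ⧸ TRGe G f)) :
    IsSubmersionGerm f := by
  have : FiniteDimensional ℝ (Theta f ⧸ (TRe f ⊔ G.lieAlg.map (matAct f))) := hfin
  have := Submodule.finiteDimensional_quotient_of_sup (TRe f) (G.lieAlg.map (matAct f))
  exact isSubmersionGerm_of_finite_codim_TRe hn hp f
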